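/- **Model.** Let $n\ge 2$ and $k\ge 1$. A ring has nodes $v_0,\dots,v_{n-1}$ (indices modulo $n$), one edge joining $v_i$ and $v_{i+1}$ for each $i$ (two parallel edges if $n=2$), and at each node one port for each of its two incident edges; each port has an incoming and an outgoing buffer. Time proceeds in synchronous rounds $0,1,2,\dots$; in each round an adversary may remove at most one edge, without any fairness restriction. The nodes carry no names, but the homebases defined next are marked. There are $k$ identical, deterministic, silent agents that execute the same protocol; initially they stand on $k$ distinct nodes, the *homebases*. Each agent has a state from a finite set, which contains an initial state and a terminal state (in the latter the agent does nothing any more), and an unbounded local memory. At the beginning of a round an agent perceives whether its node is marked, whether it is itself at the node proper or in which buffer of the node, and how many other agents are at the node proper and in each buffer of the node. From this, its state and its memory it computes its new state and memory and a direction *left*, *right* or *nil*. With *nil* it places itself at the node. Otherwise it enters the outgoing buffer of the corresponding port; if the edge is present in this round, the agent is in the incoming buffer of that edge's port at the other end at the beginning of the next round; otherwise it stays in the outgoing buffer. An agent perceives nothing about agents that traverse its edge in the opposite direction (*no cross detection*). All agents have the same notion of left and right (*chirality*). Let $h_0,\dots,h_{k-1}$ be the homebases in clockwise order and $d_i$ the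 number of edges from $h_i$ clockwise to $h_{i+1}$ (indices modulo $k$; $d_0=n$ if $k=1$). The configuration, i.e. the set of homebases, is *periodic* if for some $p$ with $0<p<k$ and $p\mid k$ we have $d_{i+p}=d_i$ for all $i$. Let $\mathcal C$ be the set of all configurations and $\mathcal P$ the set of periodic ones. *Gathering is achieved* in a round if all agents are in the same node or in two neighbouring nodes (an agent in a buffer of a node counts as being in the node). An execution *solves Gathering by round $t$* if in some round $t'\le t$ all agents are gathered, in the terminal state, and aware that gathering has been achieved, i.e. they claim it, and no agent entered the terminal state before it was true. An execution *detects periodicity* if in some round all agents are in the terminal state and report that the initial configuration is in $\mathcal P$. **Theorem.** Assume chirality and no cross detection, and let the agents know initially either only $n$ or only $k$. In each of the two cases there are a protocol, which depends on $n$ and $k$ only through the known number, and an absolute constant $c$ such that for all $n\ge 2$ and $k\ge1$, every configuration $C\in\mathcal C$ and every behaviour of the adversary: 1. if $C\in\mathcal C\setminus\mathcal P$, the execution solves Gathering by round $c\,n\log n$; 2. if $C\in\mathcal P$, the execution solves Gathering in finite time or detects periodicity. In particular, Gathering is solvable from every $C\in\mathcal C\setminus\mathcal P$. -/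

import Mathlib

/-! Gathering of anonymous, silent mobile agents in a 1-interval connected dynamic ring. -/

namespace DynRing

/-- The private names that an agent gives to the two directions of the ring. -/
inductive Dir
  | left
  | right
deriving DecidableEq

/-- The two ports of a node `v` of the ring with node set `ZMod n`:
`minus` leads to `v - 1`, and `plus` leads (clockwise) to `v + 1`. -/
inductive Side
  | minus
  | plus
deriving DecidableEq

/-- Where an agent can be inside a node: at the node itself, or in the incoming or the outgoing
buffer of one of the two ports (the ports being named by `D`). -/
inductive Place (D : Type)
  | center
  | incoming (d : D)
  | outgoing (d : D)
deriving DecidableEq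

/-- Rename the ports. -/
def Place.map {D E : Type} (f : D → E) : Place D → Place E
  | .center => .center
  | .incoming d => .incoming (f d)
  | .outgoing d => .outgoing (f d)

/-- What an agent perceives at the beginning of a round: whether its node is a marked homebase,
where in its node it is, and how many other agents of its node are in each place of the node.
Ports are named by the private orientation of the agent. There is no cross detection: nothing is
perceived about agents traversing a link in the opposite direction. -/
structure Observation where
  marked : Bool
  here : Place Dir
  others : Place Dir → ℕ

/-- A deterministic protocol, the same for all the agents. An agent has a state, out of a finite
set, and a local memory. At the start the memory holds only the one number that the agents know.
In each round the agent determines from its state, its memory and its observation the new state,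
the new memory and the direction of movement (`none` stands for *nil*). The state `term` is
terminal. `declares m` says that an agent with memory `m` reports the initial configuration to be
periodic (so that gathering is impossible); a terminated agent without this report claims that
gathering has been achieved. -/
structure Protocol where
  State : Type
  finite_state : Finite State
  init : State
  term : State
  init_ne_term : init ≠ term
  Mem : Type
  start : ℕ → Mem
  declares : Mem → Prop
  step : State → Mem → Observation → State × Mem × Option Dir
  step_term : ∀ m o, step term m o = (term, m, none)

/-- A ring with node set `ZMod n`, and `k` agents with their distinct homebases and their private
orientations, which name the ports in the same way at every node. -/
structure System (n k : ℕ) where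
  home : Fin k → ZMod n
  home_injective : Function.Injective home
  orient : Fin k → (Side ≃ Dir)

/-- The situation of one agent at the beginning of a round. -/
structure AgentConf (P : Protocol) (n : ℕ) where
  state : P.State
  mem : P.Mem
  node : ZMod n
  place : Place Side

/-- Effect of the chosen direction on the location of an agent that is in node `v`. The edge with
number `e` joins `e` and `e + 1`; `missing` is the edge that is absent in the current round, if
there is one. -/
def move {n : ℕ} (missing : Option (ZMod n)) (v : ZMod n) : Option Side → ZMod n × Place Side
  | none => (v, .center)
  | some .plus =>
      if missing = some v then (v, .outgoing .plus) else (v + 1, .incoming .minus)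
  | some .minus =>
      if missing = some (v - 1) then (v, .outgoing .minus) else (v - 1, .incoming .plus)

/-- The one number that the agents know. -/
inductive Knowledge
  | ringSize
  | numAgents

def Knowledge.value : Knowledge → ℕ → ℕ → ℕ
  | .ringSize, n, _ => n
  | .numAgents, _, k => k

/-- Number of edges from `v` clockwise to the next element of `H` (all the way round the ring
if `v` is the only element of `H`). -/
noncomputable def gap {n : ℕ} (H : Finset (ZMod n)) (v : ZMod n) : ℕ :=
  sInf {m : ℕ | 0 < m ∧ v + (m : ZMod n) ∈ H}

/-- The elements `h₀, h₁, h₂, …` of `H` in clockwise order, beginning with `h₀`; the sequence goes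
round the ring again and again. -/
noncomputable def clockwise {n : ℕ} (H : Finset (ZMod n)) (h₀ : ZMod n) : ℕ → ZMod n
  | 0 => h₀
  | i + 1 => clockwise H h₀ i + (gap H (clockwise H h₀ i) : ZMod n)

/-- The inter-distance `d i` from `hᵢ` to `hᵢ₊₁`. -/
noncomputable def interDist {n : ℕ} (H : Finset (ZMod n)) (h₀ : ZMod n) (i : ℕ) : ℕ :=
  gap H (clockwise H h₀ i)

namespace System

variable {n k : ℕ} (S : System n k)

/-- All agents agree on the orientation of the ring. -/
def Chirality : Prop := ∀ a b, S.orient a = S.orient b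

/-- The configuration: the set of the marked nodes. -/
def homebases : Finset (ZMod n) := Finset.univ.image S.home

/-- The configuration is periodic: its cyclic sequence of `k` inter-distances has a period `p`
that is a proper divisor of `k`. -/
def Periodic : Prop :=
  ∃ h₀ ∈ S.homebases, ∃ p : ℕ, 0 < p ∧ p < k ∧ p ∣ k ∧
    ∀ i, interDist S.homebases h₀ (i + p) = interDist S.homebases h₀ i

variable (P : Protocol)

/-- What agent `a` perceives. -/
def observe (c : Fin k → AgentConf P n) (a : Fin k) : Observation where
  marked := decide ((c a).node ∈ S.homebases)
  here := (c a).place.map (S.orient a)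
  others := fun q => (Finset.univ.filter fun b =>
    b ≠ a ∧ (c b).node = (c a).node ∧ (c b).place.map (S.orient a) = q).card

/-- One synchronous round. -/
def round (missing : Option (ZMod n)) (c : Fin k → AgentConf P n) : Fin k → AgentConf P n :=
  fun a =>
    let r := P.step (c a).state (c a).mem (S.observe P c a)
    let l := move missing (c a).node (r.2.2.map (S.orient a).symm)
    { state := r.1, mem := r.2.1, node := l.1, place := l.2 }

/-- The situation at the beginning of round `t`, when the agents know `K` and the adversary
removes the edge `missing s` (if any) in round `s`. -/
def exec (K : Knowledge) (missing : ℕ → Option (ZMod n)) : ℕ → Fin k → AgentConf P n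
  | 0 => fun a =>
      { state := P.init, mem := P.start (K.value n k), node := S.home a, place := .center }
  | t + 1 => S.round P (missing t) (exec K missing t)

/-- In round `t` all agents are on the same node or on two neighbouring nodes. -/
def GatheredAt (K : Knowledge) (missing : ℕ → Option (ZMod n)) (t : ℕ) : Prop :=
  ∃ v : ZMod n, ∀ a, (S.exec P K missing t a).node = v ∨ (S.exec P K missing t a).node = v + 1

/-- In round `t` all agents are in the terminal state, they are gathered, and they are aware of
it: each of them claims that gathering has been achieved, and none entered the terminal state
before that was so. -/
def SolvedAt (K : Knowledge) (missing : ℕ → Option (ZMod n)) (t : ℕ) : Prop :=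
  S.GatheredAt P K missing t ∧
  (∀ a, (S.exec P K missing t a).state = P.term ∧ ¬ P.declares (S.exec P K missing t a).mem) ∧
  ∀ s ≤ t, ∀ a, (S.exec P K missing s a).state = P.term → S.GatheredAt P K missing s

/-- In round `t` all agents are in the terminal state and report that the initial configuration
is periodic. -/
def PeriodicityDetectedAt (K : Knowledge) (missing : ℕ → Option (ZMod n)) (t : ℕ) : Prop :=
  ∀ a, (S.exec P K missing t a).state = P.term ∧ P.declares (S.exec P K missing t a).mem

end System

end DynRing

/-! ### The protocol -/

namespace DynRing

/-! By chirality all agents can walk in the same direction. Agents on one node then stay together,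
and of two agents on different nodes at most one is blocked in a round, since only one edge is
missing. So as long as two agents are apart, their step counts add up to at least the time, and
neither overtakes the other: the unrolled distance between them stays strictly between 0 and `n`.
After `3 * n` rounds either all agents have merged or each has gone round the ring
(`Exploring.le_disp`) and knows `n`, `k` and the configuration. Agents that know `k` recognise
merging by counting; for agents that know `n`, being short of `n` steps at time `3 * n` is already
proof of it. All agents share the clock, so they always stop simultaneously.

Read in binary, the configuration as seen from a node is a code. If two nodes have equal codes, a
rotation preserves the configuration, which is therefore periodic, and all agents report this.
Otherwise the node `V` of least code is a leader on which all agree (`exists_leader`). All walk to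
`V` for `2 * n` rounds. Two agents on different nodes that are both still on the way shrink their
total remaining distance in every round, which is impossible for so long (`Approaching.apart`).
Hence there remain at most two groups, one at `V` and one elsewhere.

Cutting the ring just behind `V` turns it into a path on which the two groups walk towards each
other, in a binary search for the place where the adversary separates them (`Searching.phase`). In
an interval with middle `m` the lower group heads for `m` and the upper one for `m + 1`; they try
the edge between these nodes at times of different parity, so they cannot swap unnoticed. After time
twice the length of the interval they have merged, or occupy `m` and `m + 1`, which each infers from
its own position, or lie in the same half. The lengths form a geometric series, so the search is
linear, and the whole execution takes at most `11 * n` rounds, well within the bound. -/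

/-- What an agent remembers. While exploring: the known number, a clock, the number of steps made
and the step numbers at which a mark was seen. While approaching the leader node: the size of the
ring, the number of agents, a clock and the distance that is left. While searching: which of the
two groups the agent is in, its position, the interval known to hold both groups, and a clock. -/
inductive Memory
  | explore (known clock disp : ℕ) (marks : Finset ℕ)
  | approach (n k clock dist : ℕ)
  | search (n k : ℕ) (upper : Bool) (pos lo hi clock : ℕ)
  | done (periodic : Bool)

/-- Whether the place is reached by traversing an edge, as a number. -/
def Place.arrived {D : Type} : Place D → ℕ
  | .incoming _ => 1
  | _ => 0

/-- The number of all agents in the node of the observer. -/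
def Observation.crowd (o : Observation) : ℕ :=
  o.others .center + o.others (.incoming .left) + o.others (.incoming .right) +
    o.others (.outgoing .left) + o.others (.outgoing .right) + 1

/-- Update the memory with the result of the last attempt to move. -/
def Memory.read (o : Observation) : Memory → Memory
  | .explore known c d M => .explore known c (d + o.here.arrived)
      (if o.marked then insert (d + o.here.arrived) M else M)
  | .approach n k c q => .approach n k c (q - o.here.arrived)
  | .search n k up p lo hi c => .search n k up
      (if up then p - o.here.arrived else p + o.here.arrived) lo hi c
  | .done b => .done b

open Classical in
/-- The size of the ring, once the agent has been all the way round. -/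
noncomputable def survey (K : Knowledge) (known d : ℕ) (M : Finset ℕ) : Option ℕ :=
  match K with
  | .ringSize => if known ≤ d then some known else none
  | .numAgents =>
      if ∃ p ∈ M, (M.filter (· < p)).card = known then
        some (sInf {p | p ∈ M ∧ (M.filter (· < p)).card = known})
      else none

/-- The configuration with marks at the numbers in `M`, as seen from `r`, coded by a number. -/
def code (n : ℕ) (M : Finset ℕ) (r : ℕ) : ℕ := ∑ p ∈ M, 2 ^ ((p : ZMod n) - (r : ZMod n)).val

/-- The point of view from which the configuration has the least code. -/
noncomputable def leader (n : ℕ) (M : Finset ℕ) : ℕ :=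
  sInf {r | r < n ∧ ∀ s < n, code n M r ≤ code n M s}

/-- The direction taken by a searching agent: the lower group moves forwards to the middle `m` and
tries to go on to `m + 1` at even times, the upper group moves backwards to `m + 1` and tries to go
on to `m` at odd times. -/
def searchDir (up : Bool) (p m c : ℕ) : Option Dir :=
  if up then if m + 1 < p ∨ (p = m + 1 ∧ c % 2 = 1) then some .right else none
  else if p < m ∨ (p = m ∧ c % 2 = 0) then some .left else none

open Classical in
/-- The decision of an agent in terms of its updated memory and the number of agents in its
node. -/
noncomputable def act (K : Knowledge) : Memory → ℕ → Bool × Memory × Option Dir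
  | .explore known c d M, crowd =>
      match survey K known d M with
      | none =>
          -- With `n` known, a full clock and fewer than `n` steps imply that all agents have
          -- merged; with `k` known, the agent simply counts.
          if (K = .ringSize ∧ 3 * known ≤ c) ∨ (K = .numAgents ∧ crowd = known) then
            (true, .done false, none)
          else (false, .explore known (c + 1) d M, some .left)
      | some n =>
          if (3 * n ≤ c ∨ K = .numAgents) ∧ crowd = (M.filter (· < n)).card then
            (true, .done false, none)
          else if c < 3 * n then (false, .explore known (c + 1) d M, some .left)
          else if Set.InjOn (code n (M.filter (· < n))) (Set.Iio n) then
            (false, .approach n (M.filter (· < n)).card 0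
              ((leader n (M.filter (· < n)) : ZMod n) - (d : ZMod n)).val, none)
          else (true, .done true, none)
  | .approach n k c q, crowd =>
      if crowd = k then (true, .done false, none)
      else if c < 2 * n then
        (false, .approach n k (c + 1) q, if q = 0 then none else some .left)
      else (false, .search n k (decide (q = 0)) (n - 1 - q) 0 (n - 1) 0, none)
  | .search n k up p lo hi c, crowd =>
      if crowd = k then (true, .done false, none)
      else if c < 2 * (hi - lo) then
        (false, .search n k up p lo hi (c + 1), searchDir up p ((lo + hi) / 2) c)
      -- Unmerged groups at the end of a phase: one is at its target exactly when the other is, so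
      -- the own position decides.
      else if p = (lo + hi) / 2 + (if up then 1 else 0) then (true, .done false, none)
      else if p ≤ (lo + hi) / 2 then (false, .search n k up p lo ((lo + hi) / 2) 0, none)
      else (false, .search n k up p ((lo + hi) / 2 + 1) hi 0, none)
  | .done b, _ => (true, .done b, none)

/-- The gathering protocol. -/
noncomputable def gathering (K : Knowledge) : Protocol where
  State := Bool
  finite_state := inferInstance
  init := false
  term := true
  init_ne_term := by decide
  Mem := Memory
  start := fun v => .explore v 0 0 ∅
  declares := fun m => m = .done true
  step := fun s m o => if s then (true, m, none) else act K (m.read o) o.crowd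
  step_term := by intro m o; simp

/-! ### Periodic configurations -/

section Periodicity

variable {n : ℕ} (H : Finset (ZMod n))

lemma gap_spec [NeZero n] {v : ZMod n} (hv : v ∈ H) : 0 < gap H v ∧ v + (gap H v : ZMod n) ∈ H :=
  Nat.sInf_mem (s := {m : ℕ | 0 < m ∧ v + (m : ZMod n) ∈ H}) ⟨n, NeZero.pos n, by simpa using hv⟩

lemma gap_le {v : ZMod n} {m : ℕ} (hm : 0 < m) (h : v + (m : ZMod n) ∈ H) : gap H v ≤ m :=
  Nat.sInf_le ⟨hm, h⟩

lemma gap_add {r : ZMod n} (hr : ∀ v, v + r ∈ H ↔ v ∈ H) (v : ZMod n) :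
    gap H (v + r) = gap H v := by
  unfold gap
  congr 1
  ext m
  simp only [Set.mem_ofPred_eq]
  rw [add_right_comm, hr]

lemma clockwise_mem [NeZero n] {h₀ : ZMod n} (h : h₀ ∈ H) (i : ℕ) : clockwise H h₀ i ∈ H := by
  induction i with
  | zero => exact h
  | succ i ih => exact (gap_spec H ih).2

/-- The distance walked from `h₀` clockwise to `hᵢ`. -/
noncomputable def walked (h₀ : ZMod n) (i : ℕ) : ℕ := ∑ j ∈ Finset.range i, interDist H h₀ j

lemma clockwise_eq (h₀ : ZMod n) (i : ℕ) : clockwise H h₀ i = h₀ + (walked H h₀ i : ZMod n) := by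
  induction i with
  | zero => simp [clockwise, walked]
  | succ i ih =>
    rw [clockwise, walked, Finset.sum_range_succ, ← walked, Nat.cast_add, ← add_assoc, ← ih]
    rfl

lemma walked_strictMono [NeZero n] {h₀ : ZMod n} (h : h₀ ∈ H) : StrictMono (walked H h₀) := by
  refine strictMono_nat_of_lt_succ fun i => ?_
  rw [walked, walked, Finset.sum_range_succ]
  have := (gap_spec H (clockwise_mem H h i)).1
  unfold interDist at *
  omega

/-- By minimality of the gaps the walk cannot jump over an element of `H`, and it eventually passes
`m`. -/
lemma exists_walked_eq [NeZero n] {h₀ : ZMod n} (h : h₀ ∈ H) (m : ℕ) (hm : h₀ + (m : ZMod n) ∈ H) :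
    ∃ i, walked H h₀ i = m := by
  have key : ∀ i, walked H h₀ i < m → walked H h₀ (i + 1) ≤ m := by
    intro i hi
    have := gap_le H (v := clockwise H h₀ i) (m := m - walked H h₀ i) (by omega) (by
      rw [clockwise_eq, Nat.cast_sub hi.le]; simpa using hm)
    rw [walked, Finset.sum_range_succ, ← walked]
    unfold interDist
    omega
  by_contra! hne
  have all : ∀ i, walked H h₀ i < m := by
    intro i
    induction i with
    | zero => exact lt_of_le_of_ne (by simp [walked]) (hne 0)
    | succ i ih => exact lt_of_le_of_ne (key i ih) (hne _)
  exact absurd (all m) (not_lt.2 ((walked_strictMono H h).le_apply))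

/-- Before distance `n` is reached, every element of `H` is visited exactly once. -/
lemma walked_card [NeZero n] {h₀ : ZMod n} (h : h₀ ∈ H) : walked H h₀ H.card = n := by
  obtain ⟨i, hi⟩ := exists_walked_eq H h n (by simpa using h)
  have inj : Set.InjOn (clockwise H h₀) (Finset.range i) := by
    intro a ha b hb hab
    simp only [Finset.coe_range, Set.mem_Iio] at ha hb
    rw [clockwise_eq, clockwise_eq, add_right_inj, ZMod.natCast_eq_natCast_iff'] at hab
    have ha' := (walked_strictMono H h) ha
    have hb' := (walked_strictMono H h) hb
    rw [Nat.mod_eq_of_lt (by omega), Nat.mod_eq_of_lt (by omega)] at hab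
    exact (walked_strictMono H h).injective hab
  have img : (Finset.range i).image (clockwise H h₀) = H := by
    ext v
    simp only [Finset.mem_image, Finset.mem_range]
    constructor
    · rintro ⟨a, -, rfl⟩; exact clockwise_mem H h a
    · intro hv
      obtain ⟨a, ha⟩ := exists_walked_eq H h (v - h₀).val (by simpa using hv)
      refine ⟨a, ?_, by rw [clockwise_eq, ha]; simp⟩
      have : walked H h₀ a < walked H h₀ i := by rw [ha, hi]; exact ZMod.val_lt _
      exact (walked_strictMono H h).lt_iff_lt.1 this
  have : H.card = i := by rw [← img, Finset.card_image_of_injOn inj, Finset.card_range]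
  rw [this, hi]

/-- A rotation preserving `H` that takes `h₀` to the `p`-th element commutes with passing to the
next element. -/
lemma interDist_add {h₀ : ZMod n} {p : ℕ} {r : ZMod n} (hp : clockwise H h₀ p = h₀ + r)
    (hr : ∀ v, v + r ∈ H ↔ v ∈ H) (i : ℕ) : interDist H h₀ (i + p) = interDist H h₀ i := by
  have : ∀ i, clockwise H h₀ (i + p) = clockwise H h₀ i + r := by
    intro i
    induction i with
    | zero => simpa [clockwise] using hp
    | succ i ih =>
      rw [add_right_comm, clockwise, clockwise, ih, gap_add H hr]
      ring
  unfold interDist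
  rw [this, gap_add H hr]

/-- The gcd is a multiple of `p` modulo `q`; the surplus multiples of `q` are absorbed by the period
`q`, so that all shifts go forwards. -/
lemma period_gcd {f : ℕ → ℕ} {p q : ℕ} (hp : 0 < p) (hpq : p < q) (hf : ∀ i, f (i + p) = f i)
    (hg : ∀ i, f (i + q) = f i) (i : ℕ) : f (i + p.gcd q) = f i := by
  have mul : ∀ {s : ℕ}, (∀ i, f (i + s) = f i) → ∀ a i, f (i + a * s) = f i := by
    intro s hs a
    induction a with
    | zero => simp
    | succ a ih => intro i; rw [add_mul, one_mul, ← add_assoc, hs, ih]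
  obtain ⟨b, -, hb⟩ := Nat.exists_mul_mod_eq_gcd (n := p) (k := q)
    (lt_of_le_of_lt (Nat.gcd_le_left _ hp) hpq)
  have hab : p.gcd q + p * b / q * q = b * p := by
    rw [← hb, mul_comm _ q, Nat.mod_add_div, mul_comm]
  rw [← mul hg (p * b / q), add_assoc, hab, mul hf]

end Periodicity

/-- A configuration with a rotational symmetry is periodic. -/
lemma System.periodic_of_translation {n k : ℕ} [NeZero n] (hk : 1 ≤ k) (S : System n k)
    {r : ZMod n} (hr0 : r ≠ 0) (hr : ∀ v, v + r ∈ S.homebases ↔ v ∈ S.homebases) :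
    S.Periodic := by
  have h : S.home ⟨0, hk⟩ ∈ S.homebases := by simp [System.homebases]
  have hcard : S.homebases.card = k := by
    rw [System.homebases, Finset.card_image_of_injective _ S.home_injective]; simp
  set h₀ := S.home ⟨0, hk⟩
  set H := S.homebases
  obtain ⟨p, hp⟩ := exists_walked_eq H h r.val (by simpa using (hr h₀).2 h)
  have hpr : clockwise H h₀ p = h₀ + r := by rw [clockwise_eq, hp]; simp
  have hp0 : 0 < p := by
    rcases Nat.eq_zero_or_pos p with rfl | h'
    · simp [walked] at hp; exact absurd hp.symm (by simpa using hr0)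
    · exact h'
  have hpk : p < k := by
    refine (walked_strictMono H h).lt_iff_lt.1 ?_
    rw [hp, ← hcard, walked_card H h]
    exact ZMod.val_lt r
  have hkp : clockwise H h₀ k = h₀ + 0 := by
    rw [clockwise_eq, ← hcard, walked_card H h]; simp
  refine ⟨h₀, h, p.gcd k, Nat.gcd_pos_of_pos_left _ hp0,
    lt_of_le_of_lt (Nat.gcd_le_left _ hp0) hpk, Nat.gcd_dvd_right _ _, ?_⟩
  exact period_gcd hp0 hpk (interDist_add H hpr hr) (interDist_add H hkp (by simp))

/-! ### Coordinates that increase in the common direction *left* -/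

/-- The direction of the private *left*, as a number. -/
def heading (o : Side ≃ Dir) : ℤ := if o.symm .left = .plus then 1 else -1

lemma heading_mul_self (o : Side ≃ Dir) : heading o * heading o = 1 := by
  unfold heading; split <;> simp

/-- The missing edge in coordinates that increase in the direction *left*. -/
def barrier {n : ℕ} (o : Side ≃ Dir) (e : Option (ZMod n)) : Option (ZMod n) :=
  if o.symm .left = .plus then e else e.map fun u => -(u + 1)

/-- A node in coordinates that increase in the direction *left*. -/
def coord {n : ℕ} (o : Side ≃ Dir) (v : ZMod n) : ZMod n := (heading o : ZMod n) * v

lemma heading_mul_coord {n : ℕ} (o : Side ≃ Dir) (v : ZMod n) :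
    (heading o : ZMod n) * coord o v = v := by
  rw [coord, ← mul_assoc, ← Int.cast_mul, heading_mul_self]; simp

lemma coord_injective {n : ℕ} (o : Side ≃ Dir) : Function.Injective (coord (n := n) o) :=
  Function.LeftInverse.injective (heading_mul_coord o)

lemma orient_cases (o : Side ≃ Dir) :
    (o.symm .left = .plus ∧ o.symm .right = .minus) ∨
      (o.symm .left = .minus ∧ o.symm .right = .plus) := by
  have : o.symm .left ≠ o.symm .right := by simp
  cases h : o.symm .left <;> cases h' : o.symm .right <;> simp_all

section Move

variable {n : ℕ} (o : Side ≃ Dir) (e : Option (ZMod n)) (v : ZMod n)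

/-- In these coordinates a step to the left uses the edge numbered by its starting point, whichever
way the orientation goes. The arrival bit tells the agent whether it moved. -/
lemma move_left :
    (barrier o e = some (coord o v) ∧ coord o (move e v (some (o.symm .left))).1 = coord o v ∧
        (move e v (some (o.symm .left))).2.arrived = 0) ∨
      (barrier o e ≠ some (coord o v) ∧
        coord o (move e v (some (o.symm .left))).1 = coord o v + 1 ∧
        (move e v (some (o.symm .left))).2.arrived = 1) := by
  rcases orient_cases o with ⟨h, -⟩ | ⟨h, -⟩
  · simp only [barrier, coord, heading, h, move]
    by_cases he : e = some v <;> simp [he, Place.arrived]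
  · simp only [barrier, coord, heading, h, move]
    by_cases he : e = some (v - 1)
    · left
      refine ⟨by simp [he]; ring, by simp [he], by simp [he, Place.arrived]⟩
    · right
      refine ⟨?_, by simp [he]; ring, by simp [he, Place.arrived]⟩
      rcases e with _ | e
      · simp
      · simp only [Option.some.injEq] at he
        simp only [reduceCtorEq, if_false, Option.map_some, ne_eq, Option.some.injEq]
        contrapose! he
        linear_combination -he

lemma move_right :
    (barrier o e = some (coord o v - 1) ∧ coord o (move e v (some (o.symm .right))).1 = coord o v ∧
        (move e v (some (o.symm .right))).2.arrived = 0) ∨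
      (barrier o e ≠ some (coord o v - 1) ∧
        coord o (move e v (some (o.symm .right))).1 = coord o v - 1 ∧
        (move e v (some (o.symm .right))).2.arrived = 1) := by
  rcases orient_cases o with ⟨h, h'⟩ | ⟨h, h'⟩
  · simp only [barrier, coord, heading, h, h', move]
    by_cases he : e = some (v - 1)
    · simp [he, Place.arrived]
    · right
      exact ⟨by simpa using he, by simp [he], by simp [he, Place.arrived]⟩
  · simp only [barrier, coord, heading, h, h', move]
    by_cases he : e = some v
    · simp [he, Place.arrived]; ring
    · right
      refine ⟨?_, by simp [he]; ring, by simp [he, Place.arrived]⟩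
      rcases e with _ | e
      · simp
      · simp only [Option.some.injEq] at he
        simp only [reduceCtorEq, if_false, Option.map_some, ne_eq, Option.some.injEq]
        contrapose! he
        linear_combination -he

end Move

lemma Place.arrived_map {D E : Type} (f : D → E) (p : Place D) :
    (p.map f).arrived = p.arrived := by
  cases p <;> rfl

namespace System

variable {n k : ℕ} (S : System n k)

/-- The number of agents in the node of `a`. -/
lemma crowd_observe (P : Protocol) (c : Fin k → AgentConf P n) (a : Fin k) :
    (S.observe P c a).crowd = (Finset.univ.filter fun b => (c b).node = (c a).node).card := by
  have split : (Finset.univ.filter fun b => (c b).node = (c a).node) =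
      insert a (Finset.univ.filter fun b => b ≠ a ∧ (c b).node = (c a).node) := by
    ext b
    simp only [Finset.mem_filter, Finset.mem_univ, true_and, Finset.mem_insert]
    by_cases h : b = a <;> simp [h]
  rw [split, Finset.card_insert_of_notMem (by simp), Observation.crowd]
  congr 1
  simp only [observe]
  rw [← Finset.card_union_of_disjoint, ← Finset.card_union_of_disjoint,
    ← Finset.card_union_of_disjoint, ← Finset.card_union_of_disjoint]
  · congr 1
    ext b
    simp only [Finset.mem_union, Finset.mem_filter, Finset.mem_univ, true_and]
    cases (c b).place.map (S.orient a) with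
    | center => simp
    | incoming d => cases d <;> simp
    | outgoing d => cases d <;> simp
  all_goals
    rw [Finset.disjoint_left]
    intro b
    simp only [Finset.mem_union, Finset.mem_filter, Finset.mem_univ, true_and]
    cases (c b).place.map (S.orient a) with
    | center => simp
    | incoming d => cases d <;> simp
    | outgoing d => cases d <;> simp

end System

/-! ### Executions in coordinates, and simultaneous termination -/

/-- A system with a common orientation `o`, the knowledge `K`, and the choices of the adversary. -/
structure Run (n k : ℕ) where
  S : System n k
  o : Side ≃ Dir
  orient_eq : ∀ a, S.orient a = o
  K : Knowledge
  missing : ℕ → Option (ZMod n)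

namespace Run

variable {n k : ℕ} (R : Run n k)

/-- The execution of the gathering protocol. -/
noncomputable def conf (t : ℕ) : Fin k → AgentConf (gathering R.K) n :=
  R.S.exec (gathering R.K) R.K R.missing t

/-- The coordinate of agent `a` at the beginning of round `t`. -/
noncomputable def loc (t : ℕ) (a : Fin k) : ZMod n := coord R.o (R.conf t a).node

/-- The coordinate of the homebase of agent `a`. -/
def base (a : Fin k) : ZMod n := coord R.o (R.S.home a)

/-- The configuration in coordinates. -/
def marks : Finset (ZMod n) := Finset.univ.image R.base

/-- What agent `a` perceives in round `t`. -/
noncomputable def obs (t : ℕ) (a : Fin k) : Observation := R.S.observe _ (R.conf t) a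

/-- The updated memory of agent `a` in round `t`. -/
noncomputable def view (t : ℕ) (a : Fin k) : Memory := Memory.read (R.obs t a) (R.conf t a).mem

/-- No agent has terminated before round `t` or in its beginning. -/
def Active (t : ℕ) : Prop := ∀ s ≤ t, ∀ a, (R.conf s a).state = false

/-- All agents are in the same node. -/
def Merged (t : ℕ) : Prop := ∀ a b, R.loc t a = R.loc t b

/-- The decision of agent `a` in round `t`. -/
noncomputable def decision (t : ℕ) (a : Fin k) : Bool × Memory × Option Dir :=
  act R.K (R.view t a) (R.obs t a).crowd

/-- This makes merging a local observation for agents that know `k`. -/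
lemma crowd_eq_iff (t : ℕ) (a : Fin k) : (R.obs t a).crowd = k ↔ R.Merged t := by
  rw [obs, System.crowd_observe]
  have : (Finset.univ.filter fun b => (R.conf t b).node = (R.conf t a).node).card = k ↔
      ∀ b, (R.conf t b).node = (R.conf t a).node := by
    simpa using Finset.card_filter_eq_iff (s := (Finset.univ : Finset (Fin k)))
      (p := fun b => (R.conf t b).node = (R.conf t a).node)
  rw [this]
  constructor
  · intro h b c
    rw [loc, loc, h b, h c]
  · intro h b
    exact coord_injective R.o (h b a)

lemma obs_marked (t : ℕ) (a : Fin k) : (R.obs t a).marked = decide (R.loc t a ∈ R.marks) := by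
  simp only [obs, System.observe, marks, loc, base, System.homebases, Finset.mem_image,
    Finset.mem_univ, true_and, (coord_injective R.o).eq_iff]

lemma arrived_obs (t : ℕ) (a : Fin k) :
    (R.obs t a).here.arrived = (R.conf t a).place.arrived :=
  Place.arrived_map _ _

lemma conf_succ {t : ℕ} {a : Fin k} (h : (R.conf t a).state = false) :
    R.conf (t + 1) a =
      { state := (R.decision t a).1, mem := (R.decision t a).2.1,
        node := (move (R.missing t) (R.conf t a).node
          ((R.decision t a).2.2.map R.o.symm)).1
        place := (move (R.missing t) (R.conf t a).node
          ((R.decision t a).2.2.map R.o.symm)).2 } := by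
  have : (gathering R.K).step (R.conf t a).state (R.conf t a).mem (R.obs t a) =
      R.decision t a := by
    rw [h]; rfl
  rw [← this, ← R.orient_eq a]
  rfl

lemma next_nil {t : ℕ} {a : Fin k} (h : (R.conf t a).state = false) {s : Bool} {m : Memory}
    (hd : R.decision t a = (s, m, none)) :
    (R.conf (t + 1) a).state = s ∧ (R.conf (t + 1) a).mem = m ∧
      R.loc (t + 1) a = R.loc t a ∧ (R.obs (t + 1) a).here.arrived = 0 := by
  rw [arrived_obs, loc, conf_succ R h, hd]
  exact ⟨rfl, rfl, rfl, rfl⟩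

lemma next_left {t : ℕ} {a : Fin k} (h : (R.conf t a).state = false) {s : Bool} {m : Memory}
    (hd : R.decision t a = (s, m, some .left)) :
    (R.conf (t + 1) a).state = s ∧ (R.conf (t + 1) a).mem = m ∧
      ((barrier R.o (R.missing t) = some (R.loc t a) ∧ R.loc (t + 1) a = R.loc t a ∧
          (R.obs (t + 1) a).here.arrived = 0) ∨
        (barrier R.o (R.missing t) ≠ some (R.loc t a) ∧ R.loc (t + 1) a = R.loc t a + 1 ∧
          (R.obs (t + 1) a).here.arrived = 1)) := by
  rw [arrived_obs, loc, loc, conf_succ R h, hd]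
  exact ⟨rfl, rfl, move_left _ _ _⟩

lemma next_right {t : ℕ} {a : Fin k} (h : (R.conf t a).state = false) {s : Bool} {m : Memory}
    (hd : R.decision t a = (s, m, some .right)) :
    (R.conf (t + 1) a).state = s ∧ (R.conf (t + 1) a).mem = m ∧
      ((barrier R.o (R.missing t) = some (R.loc t a - 1) ∧ R.loc (t + 1) a = R.loc t a ∧
          (R.obs (t + 1) a).here.arrived = 0) ∨
        (barrier R.o (R.missing t) ≠ some (R.loc t a - 1) ∧
          R.loc (t + 1) a = R.loc t a - 1 ∧ (R.obs (t + 1) a).here.arrived = 1)) := by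
  rw [arrived_obs, loc, loc, conf_succ R h, hd]
  exact ⟨rfl, rfl, move_right _ _ _⟩

variable {R}

lemma Active.state {t : ℕ} (h : R.Active t) (a : Fin k) : (R.conf t a).state = false :=
  h t le_rfl a

lemma Active.succ {t : ℕ} (h : R.Active t) (h' : ∀ a, (R.conf (t + 1) a).state = false) :
    R.Active (t + 1) := by
  intro s hs a
  rcases Nat.le_succ_iff.1 hs with hs | rfl
  · exact h s hs a
  · exact h' a

lemma gatheredAt_of_loc {t : ℕ} {v : ZMod n} (h : ∀ a, R.loc t a = v ∨ R.loc t a = v + 1) :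
    R.S.GatheredAt (gathering R.K) R.K R.missing t := by
  have key : ∀ a, (R.conf t a).node = heading R.o * v ∨
      (R.conf t a).node = heading R.o * (v + 1) := by
    intro a
    rw [← heading_mul_coord R.o (R.conf t a).node]
    exact (h a).imp (congrArg _) (congrArg _)
  unfold heading at key
  split at key
  · refine ⟨v, fun a => ?_⟩
    simpa [conf] using key a
  -- The reflection exchanges the two neighbours, so the image of `v + 1` comes first.
  · refine ⟨-(v + 1), fun a => ?_⟩
    have : -(v + 1) + 1 = -v := by ring
    rw [this]
    simpa [conf, or_comm] using key a

/-- If all agents terminate together, claiming that they are gathered, when they are indeed on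
one node or on two neighbouring nodes, then gathering is solved. -/
lemma Active.solved {t : ℕ} (h : R.Active t)
    (hd : ∀ a, R.decision t a = (true, .done false, none))
    {v : ZMod n} (hv : ∀ a, R.loc t a = v ∨ R.loc t a = v + 1) :
    R.S.SolvedAt (gathering R.K) R.K R.missing (t + 1) := by
  have nx := fun a => R.next_nil (h.state a) (hd a)
  have g : R.S.GatheredAt (gathering R.K) R.K R.missing (t + 1) :=
    gatheredAt_of_loc (v := v) fun a => by rw [(nx a).2.2.1]; exact hv a
  refine ⟨g, fun a => ⟨(nx a).1, fun hm => ?_⟩, fun s hs a ht => ?_⟩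
  · have : Memory.done false = .done true := (nx a).2.1.symm.trans hm
    simp at this
  · rcases Nat.le_succ_iff.1 hs with hs | rfl
    · have h1 : (R.conf s a).state = true := ht
      rw [h s hs a] at h1
      simp at h1
    · exact g

lemma Active.solved_of_merged (hk : 1 ≤ k) {t : ℕ} (h : R.Active t)
    (hd : ∀ a, R.decision t a = (true, .done false, none)) (hm : R.Merged t) :
    R.S.SolvedAt (gathering R.K) R.K R.missing (t + 1) :=
  h.solved hd (v := R.loc t ⟨0, hk⟩) fun a => Or.inl (hm a _)

lemma Active.detected {t : ℕ} (h : R.Active t)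
    (hd : ∀ a, R.decision t a = (true, .done true, none)) :
    R.S.PeriodicityDetectedAt (gathering R.K) R.K R.missing (t + 1) := fun a =>
  have nx := R.next_nil (h.state a) (hd a)
  ⟨nx.1, nx.2.1⟩

end Run

/-! ### What exploration reveals -/

section Survey

variable {n : ℕ} (H : Finset (ZMod n)) (x : ZMod n)

/-- The step numbers, up to `d`, at which an agent walking from `x` meets an element of `H`. -/
def seen (d : ℕ) : Finset ℕ := (Finset.range (d + 1)).filter fun p : ℕ => x + (p : ZMod n) ∈ H

/-- The set `H` relative to its point `x`. -/
def relative : Finset ℕ := (Finset.range n).filter fun p : ℕ => x + (p : ZMod n) ∈ H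

lemma seen_succ (d : ℕ) : seen H x (d + 1) =
    if x + ((d + 1 : ℕ) : ZMod n) ∈ H then insert (d + 1) (seen H x d) else seen H x d := by
  rw [seen, Finset.range_add_one, Finset.filter_insert]; rfl

lemma insert_seen_self {d : ℕ} (h : x + (d : ZMod n) ∈ H) :
    insert d (seen H x d) = seen H x d := by
  apply Finset.insert_eq_self.2
  simpa [seen] using h

lemma seen_filter_lt {p d : ℕ} (h : p ≤ d + 1) : (seen H x d).filter (· < p) =
    (Finset.range p).filter fun p : ℕ => x + (p : ZMod n) ∈ H := by
  ext q
  simp only [seen, Finset.mem_filter, Finset.mem_range]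
  constructor
  · rintro ⟨⟨-, h1⟩, h2⟩; exact ⟨h2, h1⟩
  · rintro ⟨h1, h2⟩; exact ⟨⟨by omega, h2⟩, h1⟩

variable [NeZero n]

lemma sum_relative {M : Type*} [AddCommMonoid M] (f : ZMod n → M) :
    ∑ p ∈ relative H x, f (x + (p : ZMod n)) = ∑ u ∈ H, f u := by
  refine Finset.sum_bij' (fun p _ => x + (p : ZMod n)) (fun u _ => (u - x).val) ?_ ?_ ?_ ?_ ?_
  · intro p hp; exact (Finset.mem_filter.1 hp).2
  · intro u hu
    simp only [relative, Finset.mem_filter, Finset.mem_range]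
    exact ⟨ZMod.val_lt _, by simpa using hu⟩
  · intro p hp
    rw [add_sub_cancel_left]
    exact ZMod.val_cast_of_lt (Finset.mem_range.1 (Finset.mem_filter.1 hp).1)
  · intro u _; simp
  · intro p _; rfl

lemma card_relative : (relative H x).card = H.card := by
  simpa only [Finset.card_eq_sum_ones] using sum_relative H x fun _ => 1

/-- Steps 0 to `n - 1` meet each mark once. A marked step before `n` is itself missing from the
count, and beyond `n` the starting point is counted twice. -/
lemma card_seen_filter_eq_iff {p d : ℕ} (hx : x ∈ H) (hp : p ∈ seen H x d) :
    ((seen H x d).filter (· < p)).card = H.card ↔ p = n := by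
  simp only [seen, Finset.mem_filter, Finset.mem_range] at hp
  rw [seen_filter_lt H x (by omega), ← card_relative H x]
  constructor
  · intro h
    rcases lt_trichotomy p n with hlt | rfl | hlt
    · refine absurd h (Finset.card_lt_card ?_).ne
      rw [Finset.ssubset_iff_of_subset]
      · exact ⟨p, by simp [relative, hlt, hp.2], by simp⟩
      · exact Finset.filter_subset_filter _ (Finset.range_subset_range.2 hlt.le)
    · rfl
    · refine absurd h (Finset.card_lt_card ?_).ne'
      rw [Finset.ssubset_iff_of_subset]
      · exact ⟨n, by simp [hlt, hx], by simp [relative]⟩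
      · exact Finset.filter_subset_filter _ (Finset.range_subset_range.2 hlt.le)
  · rintro rfl; rfl

lemma survey_seen (K : Knowledge) (hx : x ∈ H) (d : ℕ) :
    survey K (K.value n H.card) d (seen H x d) = if n ≤ d then some n else none := by
  cases K with
  | ringSize => rfl
  | numAgents =>
    have mem : n ≤ d → n ∈ seen H x d := fun h => by
      simp [seen, h, hx]
    have uniq : {p | p ∈ seen H x d ∧ ((seen H x d).filter (· < p)).card = H.card} =
        {p | p = n ∧ n ≤ d} := by
      ext p
      simp only [Set.mem_ofPred_eq]
      constructor
      · rintro ⟨h1, h2⟩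
        have := (card_seen_filter_eq_iff H x hx h1).1 h2
        subst this
        exact ⟨rfl, by simp only [seen, Finset.mem_filter, Finset.mem_range] at h1; omega⟩
      · rintro ⟨rfl, h⟩
        exact ⟨mem h, (card_seen_filter_eq_iff H x hx (mem h)).2 rfl⟩
    have ex : (∃ p ∈ seen H x d, ((seen H x d).filter (· < p)).card = H.card) ↔ n ≤ d := by
      constructor
      · rintro ⟨p, hp⟩
        exact (uniq.subset hp).2
      · intro h
        exact ⟨n, mem h, (card_seen_filter_eq_iff H x hx (mem h)).2 rfl⟩
    unfold survey
    by_cases h : n ≤ d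
    · refine (if_pos (ex.2 h)).trans ?_
      rw [if_pos h]
      congr 1
      refine (congrArg sInf uniq).trans ?_
      simp [h]
    · rw [if_neg h]
      exact if_neg fun h' => h (ex.1 h')

end Survey

/-! ### Binary codes and the leader node -/

section Code

variable {n : ℕ} [NeZero n] (H : Finset (ZMod n)) (x : ZMod n)

/-- The code of the set `H` as seen from `v`. -/
def codeAt (v : ZMod n) : ℕ := ∑ u ∈ H, 2 ^ (u - v).val

lemma code_relative (r : ℕ) : code n (relative H x) r = codeAt H (x + (r : ZMod n)) := by
  rw [codeAt, ← sum_relative H x, code]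
  simp only [add_sub_add_left_eq_sub]

/-- Binary expansions are unique, so equal codes mean that `H` looks the same from `v` and from `w`.
-/
lemma codeAt_eq {v w : ZMod n} (h : codeAt H v = codeAt H w) (u : ZMod n) :
    u + (w - v) ∈ H ↔ u ∈ H := by
  have key : ∀ v, codeAt H v = ∑ i ∈ H.image fun u => (u - v).val, 2 ^ i := by
    intro v
    rw [Finset.sum_image, codeAt]
    intro a _ b _ hab
    simpa using ZMod.val_injective n hab
  rw [key, key] at h
  have h := Finset.geomSum_injective le_rfl h
  have mem : ∀ v z, z ∈ H ↔ (z - v).val ∈ H.image fun u => (u - v).val := by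
    intro v z
    simp only [Finset.mem_image]
    constructor
    · intro hz; exact ⟨z, hz, rfl⟩
    · rintro ⟨y, hy, hyz⟩
      have := ZMod.val_injective n hyz
      rw [sub_left_inj] at this
      rwa [← this]
  rw [mem w (u + (w - v)), mem v u, h]
  congr! 2
  ring

lemma injOn_code_relative :
    Set.InjOn (code n (relative H x)) (Set.Iio n) ↔ Function.Injective (codeAt H) := by
  constructor
  · intro h v w hvw
    have : (v - x).val = (w - x).val := by
      apply h (ZMod.val_lt _) (ZMod.val_lt _)
      simpa [code_relative] using hvw
    simpa using ZMod.val_injective n this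
  · intro h r hr s hs hrs
    rw [code_relative, code_relative] at hrs
    have := add_left_cancel (h hrs)
    rwa [ZMod.natCast_eq_natCast_iff', Nat.mod_eq_of_lt hr, Nat.mod_eq_of_lt hs] at this

/-- Injectivity makes the node of least code unique, hence independent of the observer `x`. -/
lemma exists_leader (h : Function.Injective (codeAt H)) :
    ∃ V : ZMod n, ∀ x, x + (leader n (relative H x) : ZMod n) = V := by
  obtain ⟨V, -, hV⟩ := Finset.exists_min_image Finset.univ (codeAt H) ⟨0, Finset.mem_univ _⟩
  refine ⟨V, fun x => ?_⟩
  have : leader n (relative H x) ∈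
      {r | r < n ∧ ∀ s < n, code n (relative H x) r ≤ code n (relative H x) s} := by
    refine Nat.sInf_mem ⟨(V - x).val, ZMod.val_lt _, fun s _ => ?_⟩
    rw [code_relative, code_relative]
    simpa using hV _ (Finset.mem_univ _)
  obtain ⟨-, hl⟩ := this
  apply h
  apply le_antisymm _ (hV _ (Finset.mem_univ _))
  have := hl (V - x).val (ZMod.val_lt _)
  rw [code_relative, code_relative] at this
  simpa using this

end Code

namespace Run

variable {n k : ℕ} (R : Run n k)

lemma card_marks : R.marks.card = k := by
  rw [marks, Finset.card_image_of_injective]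
  · simp
  · exact (coord_injective R.o).comp R.S.home_injective

lemma base_mem (a : Fin k) : R.base a ∈ R.marks := by simp [marks]

lemma seen_filter_eq {a : Fin k} {d : ℕ} (h : n ≤ d) :
    (seen R.marks (R.base a) d).filter (· < n) = relative R.marks (R.base a) :=
  seen_filter_lt _ _ (by omega)

variable [NeZero n]

/-- A configuration whose codes are not distinct is periodic. -/
lemma periodic_of_not_injective (hk : 1 ≤ k) (h : ¬ Function.Injective (codeAt R.marks)) :
    R.S.Periodic := by
  simp only [Function.Injective, not_forall] at h
  obtain ⟨v, w, hvw, hne⟩ := h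
  have mem : ∀ u, u ∈ R.S.homebases ↔ coord R.o u ∈ R.marks := by
    intro u
    simp only [System.homebases, marks, base, Finset.mem_image, Finset.mem_univ, true_and,
      (coord_injective R.o).eq_iff]
  refine R.S.periodic_of_translation hk (r := (heading R.o : ZMod n) * (w - v)) ?_ fun u => ?_
  · intro h0
    have : coord R.o ((heading R.o : ZMod n) * (w - v)) = 0 := by rw [h0]; simp [coord]
    rw [coord, ← mul_assoc, ← Int.cast_mul, heading_mul_self] at this
    simp only [Int.cast_one, one_mul, sub_eq_zero] at this
    exact hne this.symm
  · rw [mem, mem, ← codeAt_eq R.marks hvw (coord R.o u)]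
    congr! 1
    rw [coord, coord, mul_add, ← mul_assoc, ← Int.cast_mul, heading_mul_self]
    simp

/-! ### Exploration -/

/-- All agents have been moving in the same direction, agent `a` by `D a` steps. -/
structure Exploring (t : ℕ) (D : Fin k → ℕ) : Prop where
  active : R.Active t
  view : ∀ a, R.view t a =
    .explore (R.K.value n k) t (D a) (seen R.marks (R.base a) (D a))
  loc : ∀ a, R.loc t a = R.base a + (D a : ZMod n)
  -- The middle expression is the distance from `b` to `a` in the unrolled ring, an integer rather
  -- than a residue.
  apart : ∀ a b, R.loc t a ≠ R.loc t b → t ≤ D a + D b ∧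
    0 < ((R.base a - R.base b).val : ℤ) + D a - D b ∧
    ((R.base a - R.base b).val : ℤ) + D a - D b < n

lemma exploring_zero : R.Exploring 0 fun _ => 0 where
  active := by
    intro s hs a
    rw [Nat.le_zero.1 hs]; rfl
  view := by
    intro a
    have h1 : (R.obs 0 a).here.arrived = 0 := by rw [arrived_obs]; rfl
    have h2 : (R.conf 0 a).mem = .explore (R.K.value n k) 0 0 ∅ := rfl
    have h3 : R.loc 0 a = R.base a := rfl
    rw [Run.view, h2, Memory.read, h1, obs_marked, h3]
    simp [base_mem, seen, Finset.range_one, Finset.filter_singleton]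
  loc := by intro a; simp; rfl
  apart := by
    intro a b h
    have h1 : R.loc 0 a = R.base a := rfl
    have h2 : R.loc 0 b = R.base b := rfl
    have : 0 < (R.base a - R.base b).val := by
      rw [Nat.pos_iff_ne_zero, Ne, ZMod.val_eq_zero, sub_eq_zero]
      rwa [h1, h2] at h
    have := ZMod.val_lt (R.base a - R.base b)
    refine ⟨by simp, ?_, ?_⟩ <;> push_cast <;> omega

variable {R}

lemma Exploring.succ {t : ℕ} {D : Fin k → ℕ} (h : R.Exploring t D)
    (hd : ∀ a, R.decision t a = (false, .explore (R.K.value n k) (t + 1) (D a)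
      (seen R.marks (R.base a) (D a)), some .left)) :
    ∃ D', R.Exploring (t + 1) D' := by
  have nx := fun a => R.next_left (h.active.state a) (hd a)
  have loc' : ∀ a, R.loc (t + 1) a =
      R.base a + ((D a + (R.obs (t + 1) a).here.arrived : ℕ) : ZMod n) := by
    intro a
    rcases (nx a).2.2 with ⟨-, h1, h2⟩ | ⟨-, h1, h2⟩ <;> rw [h1, h2, h.loc a] <;> push_cast <;> ring
  refine ⟨fun a => D a + (R.obs (t + 1) a).here.arrived, h.active.succ fun a => (nx a).1,
    ?_, loc', ?_⟩
  · intro a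
    rw [Run.view, (nx a).2.1, Memory.read, obs_marked, loc']
    congr 1
    rcases (nx a).2.2 with ⟨-, -, h2⟩ | ⟨-, -, h2⟩
    · simp only [h2, add_zero, decide_eq_true_eq]
      split
      · next hm => exact insert_seen_self _ _ hm
      · rfl
    · simp only [h2, decide_eq_true_eq, seen_succ]
  · intro a b hab
    -- Agents on one node face the same edge and hence stay together.
    have hne : R.loc t a ≠ R.loc t b := by
      intro he
      apply hab
      rcases (nx a).2.2 with ⟨a1, a2, -⟩ | ⟨a1, a2, -⟩ <;>
      rcases (nx b).2.2 with ⟨b1, b2, -⟩ | ⟨b1, b2, -⟩ <;> simp_all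
    obtain ⟨i1, i2, i3⟩ := h.apart a b hne
    -- The unrolled distance changes by at most 1, so it could leave the open interval only through
    -- 0 or `n`, where the agents would be on one node.
    have nz : ∀ m : ℤ, (m : ZMod n) = 0 → ((R.base a - R.base b).val : ℤ) +
        (D a + (R.obs (t + 1) a).here.arrived : ℕ) - (D b + (R.obs (t + 1) b).here.arrived : ℕ) ≠
        m := by
      intro m h0 hm
      apply hab
      rw [loc', loc', ← sub_eq_zero, ← h0, ← hm]
      push_cast
      rw [ZMod.natCast_zmod_val]
      ring
    have z0 := nz 0 (by simp)
    have zn := nz n (by simp)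
    rcases (nx a).2.2 with ⟨a1, -, a3⟩ | ⟨-, -, a3⟩ <;>
    rcases (nx b).2.2 with ⟨b1, -, b3⟩ | ⟨-, -, b3⟩
    · rw [a1] at b1
      exact absurd (Option.some.inj b1) hne
    all_goals
      simp only [a3, b3] at z0 zn ⊢
      push_cast at z0 zn ⊢
      omega

/-- After `3 n` rounds, an agent that has not been joined by all the others has gone round the
whole ring. -/
lemma Exploring.le_disp {t : ℕ} {D : Fin k → ℕ} (h : R.Exploring t D) (ht : 3 * n ≤ t)
    (hm : ¬ R.Merged t) (a : Fin k) : n ≤ D a := by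
  obtain ⟨b, hb⟩ : ∃ b, R.loc t a ≠ R.loc t b := by
    by_contra! hb
    exact hm fun c d => (hb c).symm.trans (hb d)
  obtain ⟨h1, h2, h3⟩ := h.apart a b hb
  have := ZMod.val_lt (R.base a - R.base b)
  -- With `b` less than `2 * n` ahead is not enough alone: the unrolled bound gives `D b < D a + n`,
  -- which with `3 * n ≤ D a + D b` yields `n ≤ D a`.
  omega

lemma survey_eq (a : Fin k) (d : ℕ) :
    survey R.K (R.K.value n k) d (seen R.marks (R.base a) d) =
      if n ≤ d then some n else none := by
  conv_lhs => rw [show R.K.value n k = R.K.value n R.marks.card by rw [card_marks]]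
  exact survey_seen _ _ _ (R.base_mem a) _

lemma card_relative_base (a : Fin k) : (relative R.marks (R.base a)).card = k := by
  rw [card_relative, card_marks]

/-- When only `n` is known, merging is ignored until the clock is full: agents learn `k` at
different times, yet must stop together. -/
lemma Exploring.decision_early {t : ℕ} {D : Fin k → ℕ} (h : R.Exploring t D) (ht : t < 3 * n)
    (hm : R.K = .numAgents → ¬ R.Merged t) (a : Fin k) :
    R.decision t a = (false, .explore (R.K.value n k) (t + 1) (D a)
      (seen R.marks (R.base a) (D a)), some .left) := by
  rw [decision, h.view a, act, survey_eq]
  by_cases hn : n ≤ D a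
  · simp only [if_pos hn]
    rw [R.seen_filter_eq hn, card_relative_base, if_neg, if_pos ht]
    rintro ⟨h1 | h1, h2⟩
    · omega
    · exact hm h1 ((R.crowd_eq_iff t a).1 h2)
  · simp only [if_neg hn]
    rw [if_neg]
    rintro (⟨h1, h2⟩ | ⟨h1, h2⟩)
    · rw [h1] at h2; simp only [Knowledge.value] at h2; omega
    · rw [h1] at h2; exact hm h1 ((R.crowd_eq_iff t a).1 h2)

lemma Exploring.decision_merged {t : ℕ} {D : Fin k → ℕ} (h : R.Exploring t D)
    (ht : R.K = .numAgents ∨ 3 * n ≤ t) (hm : R.Merged t) (a : Fin k) :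
    R.decision t a = (true, .done false, none) := by
  rw [decision, h.view a, act, survey_eq, (R.crowd_eq_iff t a).2 hm]
  by_cases hn : n ≤ D a
  · simp only [if_pos hn]
    rw [R.seen_filter_eq hn, card_relative_base, if_pos ⟨ht.symm, rfl⟩]
  · simp only [if_neg hn]
    rw [if_pos]
    rcases hK : R.K with _ | _
    · left; simpa [hK, Knowledge.value] using ht
    · right; simp [Knowledge.value]

lemma Exploring.decision_late {t : ℕ} {D : Fin k → ℕ} (h : R.Exploring t D)
    (ht : 3 * n ≤ t) (hm : ¬ R.Merged t) (a : Fin k) :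
    (Function.Injective (codeAt R.marks) → R.decision t a = (false, .approach n k 0
      ((leader n (relative R.marks (R.base a)) : ZMod n) - (D a : ZMod n)).val, none)) ∧
    (¬ Function.Injective (codeAt R.marks) → R.decision t a = (true, .done true, none)) := by
  have hn := h.le_disp ht hm a
  rw [decision, h.view a, act, survey_eq]
  simp only [if_pos hn]
  rw [R.seen_filter_eq hn, card_relative_base, if_neg (fun h => hm ((R.crowd_eq_iff t a).1 h.2)),
    if_neg (not_lt.2 ht)]
  exact ⟨fun h => if_pos ((injOn_code_relative _ _).2 h),
    fun h => if_neg (mt (injOn_code_relative _ _).1 h)⟩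

variable (R)

/-- Exploration either ends with gathering or leads to round `3 n`. -/
lemma explore (hk : 1 ≤ k) (t : ℕ) (ht : t ≤ 3 * n) :
    (∃ s ≤ t, R.S.SolvedAt (gathering R.K) R.K R.missing s) ∨ ∃ D, R.Exploring t D := by
  induction t with
  | zero => exact Or.inr ⟨_, R.exploring_zero⟩
  | succ t ih =>
    rcases ih (by omega) with ⟨s, hs, h⟩ | ⟨D, h⟩
    · exact Or.inl ⟨s, by omega, h⟩
    · by_cases hm : R.K = .numAgents ∧ R.Merged t
      · exact Or.inl ⟨t + 1, le_rfl,
          h.active.solved_of_merged hk (h.decision_merged (Or.inl hm.1) hm.2) hm.2⟩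
      · exact Or.inr (h.succ (h.decision_early (by omega) fun h1 h2 => hm ⟨h1, h2⟩))

end Run

namespace Run

variable {n k : ℕ} (R : Run n k)

/-! ### Approaching the leader node -/

/-- Agent `a` still has to make `q a` steps to the node `V`, after `c` rounds. -/
structure Approaching (V : ZMod n) (t c : ℕ) (q : Fin k → ℕ) : Prop where
  active : R.Active t
  view : ∀ a, R.view t a = .approach n k c (q a)
  loc : ∀ a, R.loc t a + (q a : ZMod n) = V
  lt : ∀ a, q a < n
  -- Initially `q a` and `q b` are at most `n - 1`. Each round adds 1 to `c` and removes at least 1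
  -- from `q a + q b`, as only one of the two agents can be blocked.
  apart : ∀ a b, 0 < q a → 0 < q b → R.loc t a ≠ R.loc t b → q a + q b + c + 2 ≤ 2 * n

/-- The lower group is at `w + a` and the upper one at `w + b`, where `lo ≤ a ≤ b ≤ hi`. -/
structure Searching (w : ZMod n) (up : Fin k → Bool) (t c a b lo hi : ℕ) : Prop where
  active : R.Active t
  view : ∀ i, R.view t i = .search n k (up i) (if up i then b else a) lo hi c
  loc : ∀ i, R.loc t i = w + ((if up i then b else a : ℕ) : ZMod n)
  lo_le : lo ≤ a
  le : a ≤ b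
  le_hi : b ≤ hi
  lt : hi < n

variable {R}

lemma Exploring.approaching [NeZero n] {t : ℕ} {D : Fin k → ℕ} (h : R.Exploring t D) (ht : 3 * n ≤ t)
    (hm : ¬ R.Merged t) (hinj : Function.Injective (codeAt R.marks)) :
    ∃ V q, R.Approaching V (t + 1) 0 q := by
  obtain ⟨V, hV⟩ := exists_leader R.marks hinj
  have hd := fun a => (h.decision_late ht hm a).1 hinj
  have nx := fun a => R.next_nil (h.active.state a) (hd a)
  have lt := fun a =>
    ZMod.val_lt ((leader n (relative R.marks (R.base a)) : ZMod n) - (D a : ZMod n))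
  refine ⟨V, _, h.active.succ fun a => (nx a).1, fun a => ?_, fun a => ?_, lt, fun a b _ _ _ => ?_⟩
  · rw [Run.view, (nx a).2.1, Memory.read, (nx a).2.2.2, Nat.sub_zero]
  · rw [(nx a).2.2.1, h.loc, ZMod.natCast_zmod_val, ← hV (R.base a)]
    ring
  · have := lt a
    have := lt b
    omega

lemma Approaching.decision_merged {V : ZMod n} {t c : ℕ} {q : Fin k → ℕ}
    (h : R.Approaching V t c q) (hm : R.Merged t) (i : Fin k) :
    R.decision t i = (true, .done false, none) := by
  rw [decision, h.view i, act, if_pos ((R.crowd_eq_iff t i).2 hm)]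

lemma Approaching.succ {V : ZMod n} {t c : ℕ} {q : Fin k → ℕ} (h : R.Approaching V t c q)
    (hc : c < 2 * n) (hm : ¬ R.Merged t) : ∃ q', R.Approaching V (t + 1) (c + 1) q' := by
  have hd : ∀ a, R.decision t a =
      (false, .approach n k (c + 1) (q a), if q a = 0 then none else some .left) := by
    intro a
    rw [decision, h.view a, act, if_neg (mt (R.crowd_eq_iff t a).1 hm), if_pos hc]
  have nx : ∀ a, (R.conf (t + 1) a).state = false ∧
      (R.conf (t + 1) a).mem = .approach n k (c + 1) (q a) ∧
      ((q a = 0 ∧ R.loc (t + 1) a = R.loc t a ∧ (R.obs (t + 1) a).here.arrived = 0) ∨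
        (0 < q a ∧ barrier R.o (R.missing t) = some (R.loc t a) ∧
          R.loc (t + 1) a = R.loc t a ∧ (R.obs (t + 1) a).here.arrived = 0) ∨
        (0 < q a ∧ barrier R.o (R.missing t) ≠ some (R.loc t a) ∧
          R.loc (t + 1) a = R.loc t a + 1 ∧ (R.obs (t + 1) a).here.arrived = 1)) := by
    intro a
    have hd := hd a
    split at hd
    · next h0 =>
      have := R.next_nil (h.active.state a) hd
      exact ⟨this.1, this.2.1, Or.inl ⟨h0, this.2.2⟩⟩
    · next h0 =>
      have := R.next_left (h.active.state a) hd
      have h0 := Nat.pos_of_ne_zero h0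
      exact ⟨this.1, this.2.1, Or.inr (this.2.2.imp (⟨h0, ·⟩) (⟨h0, ·⟩))⟩
  refine ⟨fun a => q a - (R.obs (t + 1) a).here.arrived, h.active.succ fun a => (nx a).1,
    fun a => ?_, fun a => ?_, fun a => ?_, fun a b ha hb hab => ?_⟩
  · rw [Run.view, (nx a).2.1, Memory.read]
  · rw [← h.loc a]
    rcases (nx a).2.2 with ⟨-, h1, h2⟩ | ⟨-, -, h1, h2⟩ | ⟨h0, -, h1, h2⟩ <;> rw [h1, h2]
    · simp
    · simp
    · rw [Nat.cast_sub h0]; push_cast; ring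
  · have := h.lt a
    omega
  · have ha' : 0 < q a := by omega
    have hb' : 0 < q b := by omega
    have hne : R.loc t a ≠ R.loc t b := by
      intro he
      apply hab
      rcases (nx a).2.2 with ⟨a0, -⟩ | ⟨-, a1, a2, -⟩ | ⟨-, a1, a2, -⟩
      · omega
      all_goals
        rcases (nx b).2.2 with ⟨b0, -⟩ | ⟨-, b1, b2, -⟩ | ⟨-, b1, b2, -⟩
        · omega
        all_goals simp_all
    have := h.apart a b ha' hb' hne
    rcases (nx a).2.2 with ⟨a0, -⟩ | ⟨-, a1, -, a2⟩ | ⟨-, -, -, a2⟩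
    · omega
    all_goals
      rcases (nx b).2.2 with ⟨b0, -⟩ | ⟨-, b1, -, b2⟩ | ⟨-, -, -, b2⟩
      · omega
      all_goals try omega
    rw [a1] at b1
    exact absurd (Option.some.inj b1) hne

/-- At `c = 2 * n` the bound on separated walkers is violated, so all agents not yet at the leader
node share one node. -/
lemma Approaching.searching [NeZero n] {V : ZMod n} {t : ℕ} {q : Fin k → ℕ}
    (h : R.Approaching V t (2 * n) q) (hm : ¬ R.Merged t) :
    ∃ w up a b, R.Searching w up (t + 1) 0 a b 0 (n - 1) := by
  have hd : ∀ a, R.decision t a =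
      (false, .search n k (decide (q a = 0)) (n - 1 - q a) 0 (n - 1) 0, none) := by
    intro a
    rw [decision, h.view a, act, if_neg (mt (R.crowd_eq_iff t a).1 hm), if_neg (lt_irrefl _)]
  have nx := fun a => R.next_nil (h.active.state a) (hd a)
  have loc : ∀ a, R.loc t a = V - (q a : ZMod n) := fun a => by rw [← h.loc a]; ring
  obtain ⟨i, hi⟩ : ∃ i, q i ≠ 0 := by
    by_contra! h0
    exact hm fun a b => by rw [loc, loc, h0, h0]
  have eq : ∀ j, (if decide (q j = 0) = true then n - 1 else n - 1 - q i : ℕ) = n - 1 - q j := by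
    intro j
    split
    · next hj => simp at hj; omega
    · next hj =>
      simp at hj
      by_cases hij : R.loc t i = R.loc t j
      · rw [loc, loc, sub_right_inj, ZMod.natCast_eq_natCast_iff', Nat.mod_eq_of_lt (h.lt _),
          Nat.mod_eq_of_lt (h.lt _)] at hij
        rw [hij]
      · have := h.apart i j (by omega) (by omega) hij
        omega
  have npos := NeZero.pos n
  -- With origin `V + 1` the leader node has the last position `n - 1`, and the search never uses
  -- the edge that closes the ring.
  refine ⟨V + 1, fun j => decide (q j = 0), n - 1 - q i, n - 1, h.active.succ fun a => (nx a).1,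
    fun j => ?_, fun j => ?_, by omega, by omega, le_rfl, by omega⟩
  · rw [Run.view, (nx j).2.1, Memory.read, (nx j).2.2.2, eq j]
    simp
  · rw [(nx j).2.2.1, eq j, loc, Nat.sub_sub, Nat.cast_sub (by have := h.lt j; omega)]
    push_cast
    simp
    ring

/-! ### Searching -/

lemma Searching.decision_merged {w : ZMod n} {up : Fin k → Bool} {t c a b lo hi : ℕ}
    (h : R.Searching w up t c a b lo hi) (hm : R.Merged t) (i : Fin k) :
    R.decision t i = (true, .done false, none) := by
  rw [decision, h.view i, act, if_pos ((R.crowd_eq_iff t i).2 hm)]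

lemma Searching.ne {w : ZMod n} {up : Fin k → Bool} {t c a b lo hi : ℕ}
    (h : R.Searching w up t c a b lo hi) (hm : ¬ R.Merged t) : a < b := by
  refine lt_of_le_of_ne h.le fun hab => hm fun i j => ?_
  rw [h.loc, h.loc, hab]; simp

/-- One round of the search: each group stays or moves in its direction, and if both try to move
then one of them does. -/
lemma Searching.succ {w : ZMod n} {up : Fin k → Bool} {t c a b lo hi : ℕ}
    (h : R.Searching w up t c a b lo hi) (hm : ¬ R.Merged t) (hc : c < 2 * (hi - lo)) :
    ∃ a' b', R.Searching w up (t + 1) (c + 1) a' b' lo hi ∧ a ≤ a' ∧ b' ≤ b ∧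
      (b' = b ∨ (lo + hi) / 2 + 1 < b ∨ b = (lo + hi) / 2 + 1 ∧ c % 2 = 1) ∧
      ((a < (lo + hi) / 2 ∨ a = (lo + hi) / 2 ∧ c % 2 = 0) →
        ((lo + hi) / 2 + 1 < b ∨ b = (lo + hi) / 2 + 1 ∧ c % 2 = 1) → b' + a < b + a') := by
  classical
  have hab := h.ne hm
  set m := (lo + hi) / 2 with hmdef
  let low := a < m ∨ a = m ∧ c % 2 = 0
  let upp := m + 1 < b ∨ b = m + 1 ∧ c % 2 = 1
  let da := if low ∧ barrier R.o (R.missing t) ≠ some (w + (a : ZMod n)) then 1 else 0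
  let db := if upp ∧ barrier R.o (R.missing t) ≠ some (w + (b : ZMod n) - 1) then 1 else 0
  have hd : ∀ i, R.decision t i =
      (false, .search n k (up i) (if up i then b else a) lo hi (c + 1),
        searchDir (up i) (if up i then b else a) m c) := by
    intro i
    rw [decision, h.view i, act, if_neg (mt (R.crowd_eq_iff t i).1 hm), if_pos hc]
  have nx : ∀ i, (R.conf (t + 1) i).state = false ∧
      (R.conf (t + 1) i).mem = .search n k (up i) (if up i then b else a) lo hi (c + 1) ∧
      (R.obs (t + 1) i).here.arrived = (if up i then db else da) ∧
      R.loc (t + 1) i = w + (if up i then (b : ZMod n) - (db : ZMod n)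
        else (a : ZMod n) + (da : ZMod n)) := by
    intro i
    have hd := hd i
    have hl := h.loc i
    have act := h.active.state i
    cases hu : up i <;> simp only [hu, searchDir, Bool.false_eq_true, if_true, if_false] at hd hl ⊢
    · split at hd
      · next ht =>
        obtain ⟨h1, h2, h3⟩ := R.next_left act hd
        refine ⟨h1, h2, ?_⟩
        rw [hl] at h3
        rcases h3 with ⟨h3, h4, h5⟩ | ⟨h3, h4, h5⟩
        · have : da = 0 := if_neg fun h' => h'.2 h3
          rw [h4, h5, this]; simp
        · have : da = 1 := if_pos ⟨ht, h3⟩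
          rw [h4, h5, this]; simp [add_assoc]
      · next ht =>
        obtain ⟨h1, h2, h4, h5⟩ := R.next_nil act hd
        refine ⟨h1, h2, ?_⟩
        have : da = 0 := if_neg fun h' => ht h'.1
        rw [h4, h5, this, hl]; simp
    · split at hd
      · next ht =>
        obtain ⟨h1, h2, h3⟩ := R.next_right act hd
        refine ⟨h1, h2, ?_⟩
        rw [hl] at h3
        rcases h3 with ⟨h3, h4, h5⟩ | ⟨h3, h4, h5⟩
        · have : db = 0 := if_neg fun h' => h'.2 h3
          rw [h4, h5, this]; simp
        · have : db = 1 := if_pos ⟨ht, h3⟩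
          rw [h4, h5, this]; simp [add_sub_assoc]
      · next ht =>
        obtain ⟨h1, h2, h4, h5⟩ := R.next_nil act hd
        refine ⟨h1, h2, ?_⟩
        have : db = 0 := if_neg fun h' => ht h'.1
        rw [h4, h5, this, hl]; simp
  have hda : da = 0 ∨ da = 1 ∧ low := by
    by_cases h' : low ∧ barrier R.o (R.missing t) ≠ some (w + (a : ZMod n))
    · exact Or.inr ⟨if_pos h', h'.1⟩
    · exact Or.inl (if_neg h')
  have hdb : db = 0 ∨ db = 1 ∧ upp := by
    by_cases h' : upp ∧ barrier R.o (R.missing t) ≠ some (w + (b : ZMod n) - 1)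
    · exact Or.inr ⟨if_pos h', h'.1⟩
    · exact Or.inl (if_neg h')
  -- Neighbours that both try would be at `m` and `m + 1`, but there their attempts have opposite
  -- parity.
  have apart : low → upp → a + 1 < b := by
    intro h1 h2
    simp only [low, upp] at h1 h2
    omega
  -- The two groups try different edges of the ring, because `a + 1 < b < n`, and only one edge is
  -- missing.
  have progress : low → upp → da = 1 ∨ db = 1 := by
    intro h1 h2
    by_cases e : barrier R.o (R.missing t) = some (w + (a : ZMod n))
    · refine Or.inr (if_pos ⟨h2, fun e' => ?_⟩)
      rw [e, Option.some.injEq, add_sub_assoc, add_right_inj, eq_sub_iff_add_eq] at e'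
      have e' : ((a + 1 : ℕ) : ZMod n) = (b : ZMod n) := by push_cast; exact e'
      have := h.le_hi
      have := h.lt
      rw [ZMod.natCast_eq_natCast_iff', Nat.mod_eq_of_lt (by omega),
        Nat.mod_eq_of_lt (by omega)] at e'
      exact (apart h1 h2).ne e'
    · exact Or.inl (if_pos ⟨h1, e⟩)
  have le : a + da ≤ b - db := by
    rcases hda with h1 | ⟨h1, h1'⟩ <;> rcases hdb with h2 | ⟨h2, h2'⟩
    · omega
    · omega
    · omega
    · have := apart h1' h2'
      omega
  have := h.lo_le
  have := h.le_hi
  have dle : db ≤ b := by omega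
  refine ⟨a + da, b - db, ⟨h.active.succ fun i => (nx i).1, fun i => ?_, fun i => ?_, by omega, le,
    by omega, h.lt⟩, by omega, by omega, ?_, fun h1 h2 => ?_⟩
  · rw [Run.view, (nx i).2.1, Memory.read, (nx i).2.2.1]
    cases up i <;> simp
  · rw [(nx i).2.2.2]
    cases up i <;> simp [Nat.cast_sub dle]
  · rcases hdb with h2 | ⟨-, h2⟩
    · left; omega
    · exact Or.inr h2
  · have := progress h1 h2
    omega

/-- The groups stay in the course of a phase of the search, or approach each other. -/
lemma Searching.phase (hk : 1 ≤ k) {w : ZMod n} {up : Fin k → Bool} {t a₀ b₀ lo hi : ℕ}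
    (h : R.Searching w up t 0 a₀ b₀ lo hi) (c : ℕ) (hc : c ≤ 2 * (hi - lo)) :
    (∃ s ≤ t + c, R.S.SolvedAt (gathering R.K) R.K R.missing s) ∨
    ∃ a b, R.Searching w up (t + c) c a b lo hi ∧
      -- While the groups straddle the middle without standing at both targets, their distance drops
      -- at least once in every two rounds. The gain is due in the even round; if the upper group
      -- waits at `m + 1` then, it may be postponed to the odd round, when both groups try.
      (a ≤ (lo + hi) / 2 → (lo + hi) / 2 < b → ¬ (a = (lo + hi) / 2 ∧ b = (lo + hi) / 2 + 1) →
        b + (c + 1) / 2 + lo ≤ hi + a ∨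
          (c % 2 = 1 ∧ b = (lo + hi) / 2 + 1 ∧ b + c / 2 + lo ≤ hi + a)) := by
  induction c with
  | zero =>
    refine Or.inr ⟨a₀, b₀, h, fun _ _ _ => Or.inl ?_⟩
    have := h.lo_le
    have := h.le_hi
    omega
  | succ c ih =>
    rcases ih (by omega) with ⟨s, hs, h⟩ | ⟨a, b, h, hp⟩
    · exact Or.inl ⟨s, by omega, h⟩
    by_cases hm : R.Merged (t + c)
    · exact Or.inl ⟨t + c + 1, by omega,
        h.active.solved_of_merged hk (h.decision_merged hm) hm⟩
    · obtain ⟨a', b', h', h1, h2, h3, h4⟩ := h.succ hm (by omega)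
      refine Or.inr ⟨a', b', h', fun g1 g2 g3 => ?_⟩
      generalize (lo + hi) / 2 = m at *
      rcases Nat.mod_two_eq_zero_or_one c with hc2 | hc2 <;> omega

/-- The end of a phase in which the groups have not become neighbours: the interval is halved. -/
lemma Searching.narrow {w : ZMod n} {up : Fin k → Bool} {t a b lo hi lo' hi' : ℕ}
    (h : R.Searching w up t (2 * (hi - lo)) a b lo hi) (hm : ¬ R.Merged t)
    (h' : (b ≤ (lo + hi) / 2 ∧ lo' = lo ∧ hi' = (lo + hi) / 2) ∨
      ((lo + hi) / 2 < a ∧ lo' = (lo + hi) / 2 + 1 ∧ hi' = hi)) :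
    R.Searching w up (t + 1) 0 a b lo' hi' := by
  have hab := h.ne hm
  have hd : ∀ i, R.decision t i =
      (false, .search n k (up i) (if up i then b else a) lo' hi' 0, none) := by
    intro i
    rw [decision, h.view i, act, if_neg (mt (R.crowd_eq_iff t i).1 hm), if_neg (lt_irrefl _)]
    rcases h' with ⟨h1, rfl, rfl⟩ | ⟨h1, rfl, rfl⟩
    · rw [if_neg, if_pos]
      all_goals cases up i <;> simp <;> omega
    · rw [if_neg, if_neg]
      all_goals cases up i <;> simp <;> omega
  have nx := fun i => R.next_nil (h.active.state i) (hd i)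
  have := h.lo_le
  have := h.le_hi
  have := h.lt
  refine ⟨h.active.succ fun i => (nx i).1, fun i => ?_, fun i => ?_, by omega, h.le, by omega,
    by omega⟩
  · rw [Run.view, (nx i).2.1, Memory.read, (nx i).2.2.2]
    simp
  · rw [(nx i).2.2.1, h.loc]

/-- A search in an interval of length `l` ends with gathering, in at most `6 * l + 1` rounds. -/
lemma Searching.solved (hk : 1 ≤ k) (l : ℕ) {w : ZMod n} {up : Fin k → Bool}
    {t a₀ b₀ lo hi : ℕ} (h₀ : R.Searching w up t 0 a₀ b₀ lo hi) (hl : hi - lo = l) :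
    ∃ s ≤ t + 6 * l + 1, R.S.SolvedAt (gathering R.K) R.K R.missing s := by
  induction l using Nat.strong_induction_on generalizing t a₀ b₀ lo hi with
  | _ l ih =>
    rcases h₀.phase hk (2 * (hi - lo)) le_rfl with ⟨s, hs, h⟩ | ⟨a, b, h, hp⟩
    · exact ⟨s, by omega, h⟩
    by_cases hm : R.Merged (t + 2 * (hi - lo))
    · exact ⟨_, by omega, h.active.solved_of_merged hk (h.decision_merged hm) hm⟩
    have hab := h.ne hm
    have := h.lo_le
    have := h.le_hi
    by_cases hadj : a = (lo + hi) / 2 ∧ b = (lo + hi) / 2 + 1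
    · refine ⟨_, by omega, h.active.solved (fun i => ?_) (v := w + (a : ZMod n)) fun i => ?_⟩
      · rw [decision, h.view i, act, if_neg (mt (R.crowd_eq_iff _ i).1 hm), if_neg (lt_irrefl _),
          if_pos]
        cases up i <;> simp [hadj]
      · rw [h.loc, hadj.2, ← hadj.1]
        cases up i
        · simp
        · right; simp [add_assoc]
    -- At the even time `2 * (hi - lo)` the bound of `hp` would give `b ≤ a`, so the groups do not
    -- straddle the middle. A phase costs `2 * l + 1` rounds and leaves length at most `l / 2`,
    -- which fits into `6 * l + 1` because `l ≥ 1`.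
    · by_cases hb : b ≤ (lo + hi) / 2
      · obtain ⟨s, hs, hS⟩ := ih _ (by omega) (h.narrow hm (Or.inl ⟨hb, rfl, rfl⟩)) rfl
        exact ⟨s, by omega, hS⟩
      · obtain ⟨s, hs, hS⟩ := ih _ (by omega) (h.narrow hm (Or.inr ⟨by omega, rfl, rfl⟩)) rfl
        exact ⟨s, by omega, hS⟩

variable (R)

/-- Every run ends in `11 * n` rounds with gathering or with a justified report of
periodicity. -/
lemma outcome [NeZero n] (hk : 1 ≤ k) :
    (∃ t ≤ 11 * n, R.S.SolvedAt (gathering R.K) R.K R.missing t) ∨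
      (R.S.Periodic ∧ ∃ t, R.S.PeriodicityDetectedAt (gathering R.K) R.K R.missing t) := by
  have npos := NeZero.pos n
  rcases R.explore hk (3 * n) le_rfl with ⟨s, hs, h⟩ | ⟨D, h⟩
  · exact Or.inl ⟨s, by omega, h⟩
  by_cases hm : R.Merged (3 * n)
  · exact Or.inl ⟨3 * n + 1, by omega,
      h.active.solved_of_merged hk (h.decision_merged (Or.inr le_rfl) hm) hm⟩
  by_cases hinj : Function.Injective (codeAt R.marks)
  · left
    obtain ⟨V, q₀, h₀⟩ := h.approaching le_rfl hm hinj
    have approach : ∀ c ≤ 2 * n,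
        (∃ s ≤ 3 * n + 1 + c, R.S.SolvedAt (gathering R.K) R.K R.missing s) ∨
          ∃ q, R.Approaching V (3 * n + 1 + c) c q := by
      intro c
      induction c with
      | zero => exact fun _ => Or.inr ⟨q₀, h₀⟩
      | succ c ih =>
        intro hc
        rcases ih (by omega) with ⟨s, hs, h⟩ | ⟨q, h⟩
        · exact Or.inl ⟨s, by omega, h⟩
        by_cases hm : R.Merged (3 * n + 1 + c)
        · exact Or.inl ⟨3 * n + 1 + c + 1, by omega,
            h.active.solved_of_merged hk (h.decision_merged hm) hm⟩
        · exact Or.inr (h.succ (by omega) hm)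
    rcases approach (2 * n) le_rfl with ⟨s, hs, h⟩ | ⟨q, h⟩
    · exact ⟨s, by omega, h⟩
    by_cases hm : R.Merged (3 * n + 1 + 2 * n)
    · exact ⟨3 * n + 1 + 2 * n + 1, by omega,
        h.active.solved_of_merged hk (h.decision_merged hm) hm⟩
    obtain ⟨w, up, a, b, h⟩ := h.searching hm
    obtain ⟨s, hs, hS⟩ := h.solved hk _ rfl
    -- The total is `(3 * n + 1) + (2 * n + 1) + (6 * (n - 1) + 1)`, at most `11 * n`.
    exact ⟨s, by omega, hS⟩
  · exact Or.inr ⟨R.periodic_of_not_injective hk hinj, _,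
      h.active.detected fun a => (h.decision_late le_rfl hm a).2 hinj⟩

end Run

end DynRing

/-! ### The theorem -/

theorem mainTheorem4 (K : DynRing.Knowledge) :
    ∃ (P : DynRing.Protocol) (c : ℝ), ∀ (n k : ℕ), 2 ≤ n → 1 ≤ k →
      ∀ S : DynRing.System n k, S.Chirality →
      ∀ missing : ℕ → Option (ZMod n),
        (¬ S.Periodic →
          ∃ t : ℕ, (t : ℝ) ≤ c * (n * Real.log n) ∧ S.SolvedAt P K missing t) ∧
        (S.Periodic →
          ∃ t : ℕ, S.SolvedAt P K missing t ∨ S.PeriodicityDetectedAt P K missing t) := by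
  -- Since `log n ≥ log 2 ≥ 1 / 2`, the linear bound `11 * n` is at most `22 * (n * log n)`.
  refine ⟨DynRing.gathering K, 22, fun n k hn hk S hS missing => ?_⟩
  have : NeZero n := ⟨by omega⟩
  have key := DynRing.Run.outcome ⟨S, S.orient ⟨0, hk⟩, fun a => hS a _, K, missing⟩ hk
  refine ⟨fun hP => ?_, fun _ => ?_⟩
  · rcases key with ⟨t, ht, h⟩ | ⟨h, -⟩
    · refine ⟨t, ?_, h⟩
      have h1 : (t : ℝ) ≤ 11 * n := by exact_mod_cast ht
      have h2 : (1 : ℝ) / 2 ≤ Real.log n := by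
        have := Real.log_two_gt_d9
        have h3 : Real.log 2 ≤ Real.log n := Real.log_le_log (by norm_num) (by exact_mod_cast hn)
        linarith
      have h4 : (n : ℝ) * (1 / 2) ≤ n * Real.log n := by gcongr
      linarith
    · exact absurd h hP
  · rcases key with ⟨t, -, h⟩ | ⟨-, t, h⟩
    · exact ⟨t, Or.inl h⟩
    · exact ⟨t, Or.inr h⟩
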